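/- Let $A$ be a uniform algebra, that is, a commutative Banach algebra isometrically isomorphic to a closed subalgebra of $C(K)$, for some compact Hausdorff space $K$, that contains the constants and separates the points of $K$. Let $\Delta(A)$ be its Gelfand space, the set of non-zero multiplicative linear functionals on $A$ with the weak$^{*}$ topology. Assume that $\Delta(A)$ is scattered, i.e. every non-empty subset of $\Delta(A)$ has a relatively isolated point, and that $A\in NP_\infty$, i.e. for every $n$, all pairwise distinct $\varphi_1,\dots,\varphi_n\in\Delta(A)$ and all $(a_1,\dots,a_n)\in\mathbb{C}^n$, $$\inf\{\|x\|_A : x\in A,\ \varphi_i(x)=a_i \text{ for } i=1,\dots,n\}=\max_{1\le i\le n}|a_i|.$$ Then $A=C(\Delta(A))$, i.e. the Gelfand transform $x\mapsto\widehat{x}$, $\widehat{x}(\varphi)=\varphi(x)$, is an isometric isomorphism of $A$ onto $C(\Delta(A))$. -/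

import Mathlib

open WeakDual

/-- A topological space is scattered if every nonempty subset has a point that is isolated in the
relative topology of that subset. -/
def IsScattered (X : Type*) [TopologicalSpace X] : Prop :=
  ∀ S : Set X, S.Nonempty → ∃ x ∈ S, ∃ U : Set X, IsOpen U ∧ U ∩ S = {x}

/-- A uniform algebra on the space `K`: a closed subalgebra of `C(K)` that contains the constants
(this is built into `Subalgebra`) and separates the points of `K`. -/
structure IsUniformSubalgebra {K : Type*} [TopologicalSpace K] [CompactSpace K]
    (B : Subalgebra ℂ C(K, ℂ)) : Prop where
  isClosed : IsClosed (B : Set C(K, ℂ))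
  separatesPoints : B.SeparatesPoints

/-- A normed algebra is a uniform algebra if it is isometrically isomorphic to a uniform algebra on
some compact Hausdorff space. A uniform algebra `B` on `K` is itself an instance, through the
identity. -/
def IsUniformAlgebra.{u} (A : Type u) [NormedCommRing A] [NormedAlgebra ℂ A] : Prop :=
  ∃ (K : Type u) (_ : TopologicalSpace K) (_ : CompactSpace K) (_ : T2Space K)
    (B : Subalgebra ℂ C(K, ℂ)) (e : A ≃ₐ[ℂ] B), IsUniformSubalgebra B ∧ Isometry e

/-- The Nevanlinna-Pick norm of `a ∈ ℂⁿ` with respect to the characters `φ₁, …, φₙ` of `A`. For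
pairwise distinct characters the set of interpolating elements is nonempty. -/
noncomputable def npNorm (A : Type*) [NormedCommRing A] [NormedAlgebra ℂ A] {n : ℕ}
    (φ : Fin n → characterSpace ℂ A) (a : Fin n → ℂ) : ℝ :=
  sInf {r : ℝ | ∃ x : A, (∀ i, φ i x = a i) ∧ r = ‖x‖}

/-- Membership in the class `NP_∞`: all Nevanlinna-Pick norms are supremum norms (the norm of
`Fin n → ℂ` is the supremum norm). The class is considered among semisimple algebras, and every
uniform algebra is semisimple. -/
def MemNPInfty (A : Type*) [NormedCommRing A] [NormedAlgebra ℂ A] : Prop :=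
  ∀ (n : ℕ) (φ : Fin n → characterSpace ℂ A), Function.Injective φ →
    ∀ a : Fin n → ℂ, npNorm A φ a = ‖a‖

/-!
A continuous map from a compact scattered space to a perfect Hausdorff space has a range with empty
interior: on a minimal closed subset still covering a nonempty set without isolated points, a
relatively isolated point could be removed. Consequently, if a Gelfand transform `f` separates the
characters `φ` and `ψ`, there is a radius `0 < r < |f ψ - f φ|` which `|f - f φ|` never attains.
With `w = (f - f φ) / r`, the functions `(1 + wⁿ)⁻¹` converge uniformly to the indicator function
of the clopen set `{|w| < 1}`, which contains `φ` but not `ψ`. They are Gelfand transforms, because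
an element of `A` is invertible as soon as its Gelfand transform has no zero. Since the Gelfand
transform of a uniform algebra is isometric, its range is closed, so it contains these indicator
functions. They are real-valued and separate points, and the Stone-Weierstrass theorem applies.
-/

open Filter Topology Set

section Scattered

variable {X Y : Type*} [TopologicalSpace X] [CompactSpace X] [TopologicalSpace Y] {g : X → Y}
  {S : Set Y}

theorem subset_image_sInter_of_isChain [T1Space Y] (hg : Continuous g) {C : Set (Set X)}
    (hC : IsChain (· ⊆ ·) C) (hne : C.Nonempty) (hclosed : ∀ Z ∈ C, IsClosed Z)
    (hcover : ∀ Z ∈ C, S ⊆ g '' Z) : S ⊆ g '' ⋂₀ C := by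
  intro t ht
  have : Nonempty C := hne.to_subtype
  have hfiber (Z : C) : IsClosed ((Z : Set X) ∩ g ⁻¹' {t}) :=
    (hclosed Z Z.2).inter (isClosed_singleton.preimage hg)
  have hdirected : Directed (· ⊇ ·) fun Z : C => (Z : Set X) ∩ g ⁻¹' {t} := by
    intro Z W
    rcases hC.total Z.2 W.2 with h | h
    · exact ⟨Z, subset_rfl, inter_subset_inter_left _ h⟩
    · exact ⟨W, inter_subset_inter_left _ h, subset_rfl⟩
  obtain ⟨x, hx⟩ := IsCompact.nonempty_iInter_of_directed_nonempty_isCompact_isClosed _ hdirected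
    (fun Z => hcover Z Z.2 ht) (fun Z => (hfiber Z).isCompact) hfiber
  rw [← iInter_inter, ← sInter_eq_iInter] at hx
  exact ⟨x, hx⟩

theorem exists_minimal_isClosed_subset_image [T1Space Y] (hg : Continuous g) (hS : S ⊆ range g) :
    ∃ Z, Minimal (fun Z : Set X => IsClosed Z ∧ S ⊆ g '' Z) Z := by
  refine zorn_superset {Z : Set X | IsClosed Z ∧ S ⊆ g '' Z} fun C hC hchain => ?_
  rcases C.eq_empty_or_nonempty with rfl | hne
  · exact ⟨univ, ⟨isClosed_univ, by rwa [image_univ]⟩, by simp⟩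
  · exact ⟨⋂₀ C, ⟨isClosed_sInter fun Z hZ => (hC hZ).1,
      subset_image_sInter_of_isChain hg hchain hne (fun Z hZ => (hC hZ).1) fun Z hZ => (hC hZ).2⟩,
      fun Z hZ => sInter_subset_of_mem hZ⟩

theorem IsScattered.not_subset_range_of_preperfect [T2Space Y] (hX : IsScattered X)
    (hg : Continuous g) (hS : Preperfect S) (hne : S.Nonempty) : ¬S ⊆ range g := by
  intro hrange
  obtain ⟨Z, ⟨hZ, hSZ⟩, hmin⟩ := exists_minimal_isClosed_subset_image hg hrange
  obtain ⟨z, hz, U, hU, hUZ⟩ := hX Z (hne.mono hSZ).of_image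
  have hZU : IsClosed (Z \ U) := hZ.sdiff hU
  have hcover : S \ {g z} ⊆ g '' (Z \ U) := by
    rintro s ⟨hs, hsz⟩
    obtain ⟨x, hx, rfl⟩ := hSZ hs
    refine ⟨x, ⟨hx, fun hxU => hsz ?_⟩, rfl⟩
    obtain rfl : x = z := by simpa [hUZ] using mem_inter hxU hx
    rfl
  have hclosure : S ⊆ closure (S \ {g z}) := by
    intro s hs
    rcases eq_or_ne s (g z) with rfl | hsz
    · exact mem_closure_iff_clusterPt.2 (accPt_principal_iff_clusterPt.1 (hS _ hs))
    · exact subset_closure ⟨hs, hsz⟩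
  have hSZU : S ⊆ g '' (Z \ U) :=
    hclosure.trans (closure_minimal hcover (hZU.isCompact.image hg).isClosed)
  have hzU : z ∈ U ∩ Z := by simp [hUZ]
  exact (hmin ⟨hZU, hSZU⟩ sdiff_subset hz).2 hzU.1

theorem IsScattered.dense_compl_range [T2Space Y] [PerfectSpace Y] (hX : IsScattered X)
    (hg : Continuous g) : Dense (range g)ᶜ := by
  rw [← interior_eq_empty_iff_dense_compl, ← not_nonempty_iff_eq_empty]
  exact fun hne =>
    hX.not_subset_range_of_preperfect hg isOpen_interior.preperfect hne interior_subset

end Scattered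

section Indicator

theorem isClopen_setOf_lt_of_forall_ne {X α : Type*} [TopologicalSpace X] [TopologicalSpace α]
    [LinearOrder α] [OrderClosedTopology α] {f : X → α} (hf : Continuous f) {a : α}
    (ha : ∀ x, f x ≠ a) : IsClopen {x | f x < a} := by
  refine ⟨?_, isOpen_lt hf continuous_const⟩
  simp_rw [← (ha _).le_iff_lt]
  exact isClosed_le hf continuous_const

theorem tendstoLocallyUniformly_of_tendsto_prod_nhds {ι X Y : Type*} [TopologicalSpace X]
    [UniformSpace Y] {F : ι → X → Y} {f : X → Y} {l : Filter ι} (hf : Continuous f)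
    (hF : ∀ x, Tendsto (fun p : ι × X => F p.1 p.2) (l ×ˢ 𝓝 x) (𝓝 (f x))) :
    TendstoLocallyUniformly F f l :=
  tendstoLocallyUniformly_iff_forall_tendsto.2 fun x =>
    (((hf.tendsto x).comp tendsto_snd).prodMk_nhds (hF x)).mono_right (nhds_le_uniformity (f x))

variable {ι 𝕜 : Type*} [NormedDivisionRing 𝕜] {l : Filter ι} {u : ι → 𝕜} {n : ι → ℕ} {a : 𝕜}

theorem tendsto_inv_one_add_pow_of_norm_lt_one (hu : Tendsto u l (𝓝 a)) (hn : Tendsto n l atTop)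
    (ha : ‖a‖ < 1) : Tendsto (fun i => (1 + u i ^ n i)⁻¹) l (𝓝 1) := by
  obtain ⟨r, har, hr⟩ := exists_between ha
  have hpow : Tendsto (fun i => u i ^ n i) l (𝓝 0) := by
    refine squeeze_zero_norm' ?_ ((tendsto_pow_atTop_nhds_zero_of_lt_one
      ((norm_nonneg a).trans har.le) hr).comp hn)
    filter_upwards [hu.norm.eventually_lt_const har] with i hi
    exact (norm_pow _ _).trans_le (pow_le_pow_left₀ (norm_nonneg _) hi.le _)
  simpa using (hpow.const_add 1).inv₀ (by simp)

theorem tendsto_inv_one_add_pow_of_one_lt_norm (hu : Tendsto u l (𝓝 a)) (hn : Tendsto n l atTop)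
    (ha : 1 < ‖a‖) : Tendsto (fun i => (1 + u i ^ n i)⁻¹) l (𝓝 0) := by
  obtain ⟨r, hr, hra⟩ := exists_between ha
  have hpow : Tendsto (fun i => u i ^ n i) l (Bornology.cobounded 𝕜) := by
    refine tendsto_norm_atTop_iff_cobounded.1 (tendsto_atTop_mono' l ?_
      ((tendsto_pow_atTop_atTop_of_one_lt hr).comp hn))
    filter_upwards [hu.norm.eventually_const_lt hra] with i hi
    exact (pow_le_pow_left₀ (zero_le_one.trans hr.le) hi.le _).trans_eq (norm_pow _ _).symm
  exact tendsto_inv₀_cobounded.comp ((tendsto_const_add_cobounded 1).comp hpow)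

theorem tendstoLocallyUniformly_inv_one_add_pow {X : Type*} [TopologicalSpace X] {w : X → 𝕜}
    (hw : Continuous w) (hw1 : ∀ x, ‖w x‖ ≠ 1) :
    TendstoLocallyUniformly (fun (n : ℕ) x => (1 + w x ^ n)⁻¹) ({x | ‖w x‖ < 1}.indicator 1)
      atTop := by
  have hclopen : IsClopen {x | ‖w x‖ < 1} := isClopen_setOf_lt_of_forall_ne hw.norm hw1
  refine tendstoLocallyUniformly_of_tendsto_prod_nhds
    (hclopen.continuous_indicator continuous_const) fun x => ?_
  have hwx : Tendsto (fun p : ℕ × X => w p.2) (atTop ×ˢ 𝓝 x) (𝓝 (w x)) :=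
    (hw.tendsto x).comp tendsto_snd
  rcases (hw1 x).lt_or_gt with hx | hx
  · simpa [hx] using tendsto_inv_one_add_pow_of_norm_lt_one hwx tendsto_fst hx
  · simpa [hx.not_gt] using tendsto_inv_one_add_pow_of_one_lt_norm hwx tendsto_fst hx

end Indicator

section InverseClosed

/-- A subalgebra is inverse-closed, or full, if it contains the inverse of each of its elements
that is invertible in the ambient algebra. -/
def IsInverseClosed {R A : Type*} [CommSemiring R] [Semiring A] [Algebra R A]
    (B : Subalgebra R A) : Prop :=
  ∀ a ∈ B, IsUnit a → Ring.inverse a ∈ B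

theorem map_ringInverse_of_isUnit {M N F : Type*} [MonoidWithZero M] [MonoidWithZero N]
    [FunLike F M N] [MonoidHomClass F M N] (φ : F) {a : M} (ha : IsUnit a) :
    φ (Ring.inverse a) = Ring.inverse (φ a) := by
  obtain ⟨u, rfl⟩ := ha
  calc φ (Ring.inverse u) = Units.map (φ : M →* N) u⁻¹ := congrArg φ (Ring.inverse_unit u)
    _ = Ring.inverse (φ u) := by
      rw [map_inv]
      exact (Ring.inverse_unit _).symm

theorem isInverseClosed_range {R A B : Type*} [CommSemiring R] [Semiring A] [Semiring B]
    [Algebra R A] [Algebra R B] (φ : A →ₐ[R] B) [IsLocalHom φ] : IsInverseClosed φ.range := by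
  rintro _ ⟨a, rfl⟩ ha
  exact ⟨Ring.inverse a, map_ringInverse_of_isUnit φ (ha.of_map φ a)⟩

end InverseClosed

section StoneWeierstrass

variable {X 𝕜 : Type*} [TopologicalSpace X] [CompactSpace X] [RCLike 𝕜] {B : Subalgebra 𝕜 C(X, 𝕜)}

theorem subalgebra_eq_top_of_isClosed_of_separatesPoints_isSelfAdjoint
    (hB : IsClosed (B : Set C(X, 𝕜)))
    (hsep : ∀ x y, x ≠ y → ∃ f ∈ B, IsSelfAdjoint f ∧ f x ≠ f y) : B = ⊤ := by
  let S : StarSubalgebra 𝕜 C(X, 𝕜) :=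
    { B ⊓ star B with
      star_mem' := fun {f} hf => ⟨hf.2, by simpa using hf.1⟩ }
  have hS : S.SeparatesPoints := by
    intro x y hxy
    obtain ⟨f, hf, hstar, hne⟩ := hsep x y hxy
    exact ⟨f, ⟨f, ⟨hf, by simpa [hstar.star_eq] using hf⟩, rfl⟩, hne⟩
  have hclosure : closure (S : Set C(X, 𝕜)) = univ := by
    simpa using congrArg (fun T : StarSubalgebra 𝕜 C(X, 𝕜) => (T : Set C(X, 𝕜)))
      (ContinuousMap.starSubalgebra_topologicalClosure_eq_top_of_separatesPoints S hS)
  exact eq_top_iff.2 fun f _ => closure_minimal (fun g hg => hg.1) hB (hclosure.ge (mem_univ f))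

theorem mem_of_coe_eq_indicator_norm_lt_one (hB : IsClosed (B : Set C(X, 𝕜)))
    (hinv : IsInverseClosed B) {w χ : C(X, 𝕜)} (hw : w ∈ B) (hw1 : ∀ x, ‖w x‖ ≠ 1)
    (hχ : ⇑χ = {x | ‖w x‖ < 1}.indicator (1 : X → 𝕜)) : χ ∈ B := by
  have hunit (n : ℕ) : IsUnit (1 + w ^ n) := by
    refine (ContinuousMap.isUnit_iff_forall_ne_zero _).2 fun x hx => ?_
    have hpow : w x ^ n = -1 := eq_neg_of_add_eq_zero_right hx
    rcases eq_or_ne n 0 with rfl | hn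
    · norm_num at hpow
    · exact hw1 x ((pow_eq_one_iff_of_nonneg (norm_nonneg _) hn).1 (by simp [← norm_pow, hpow]))
  have hlim : Tendsto (fun n : ℕ => Ring.inverse (1 + w ^ n)) atTop (𝓝 χ) := by
    rw [ContinuousMap.tendsto_iff_tendstoLocallyUniformly, hχ]
    convert tendstoLocallyUniformly_inv_one_add_pow w.continuous hw1 using 3 with n x
    exact (map_ringInverse_of_isUnit (ContinuousMap.evalAlgHom 𝕜 𝕜 x) (hunit n)).trans
      (Ring.inverse_eq_inv _)
  exact hB.mem_of_tendsto hlim (Eventually.of_forall fun n =>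
    hinv _ (B.add_mem B.one_mem (B.pow_mem hw n)) (hunit n))

theorem IsScattered.subalgebra_eq_top (hX : IsScattered X) (hB : IsClosed (B : Set C(X, 𝕜)))
    (hsep : B.SeparatesPoints) (hinv : IsInverseClosed B) : B = ⊤ := by
  refine subalgebra_eq_top_of_isClosed_of_separatesPoints_isSelfAdjoint hB fun x y hxy => ?_
  obtain ⟨_, ⟨f, hf, rfl⟩, hfxy⟩ := hsep hxy
  have hdist : Continuous fun z => ‖f z - f x‖ := by fun_prop
  obtain ⟨r, hr, hr0, hry⟩ := (hX.dense_compl_range hdist).exists_between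
    (norm_sub_pos_iff.2 (Ne.symm hfxy))
  let w : C(X, 𝕜) := (r : 𝕜)⁻¹ • (f - algebraMap 𝕜 C(X, 𝕜) (f x))
  have hw : w ∈ B := B.smul_mem (B.sub_mem hf (B.algebraMap_mem _)) _
  have hnorm (z : X) : ‖w z‖ = ‖f z - f x‖ / r := by
    simp [w, abs_of_pos hr0, div_eq_inv_mul]
  have hw1 (z : X) : ‖w z‖ ≠ 1 := by
    rw [hnorm, Ne, div_eq_one_iff_eq hr0.ne']
    exact fun hz => hr ⟨z, hz⟩
  have hclopen : IsClopen {z | ‖w z‖ < 1} :=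
    isClopen_setOf_lt_of_forall_ne (by fun_prop) hw1
  let χ : C(X, 𝕜) := LocallyConstant.charFn 𝕜 hclopen
  have hχ : ⇑χ = {z | ‖w z‖ < 1}.indicator (1 : X → 𝕜) := LocallyConstant.coe_charFn 𝕜 hclopen
  refine ⟨χ, mem_of_coe_eq_indicator_norm_lt_one hB hinv hw hw1 hχ, ?_, ?_⟩
  · ext z
    by_cases hz : ‖w z‖ < 1 <;> simp [hχ, hz]
  · have hx : ‖w x‖ < 1 := by simp [hnorm]
    have hy : ¬‖w y‖ < 1 := by simpa [hnorm] using ((one_lt_div hr0).2 hry).le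
    simp [hχ, hx, hy]

end StoneWeierstrass

section Gelfand

theorem separatesPoints_range_gelfandTransform {𝕜 A : Type*} [CommRing 𝕜] [NoZeroDivisors 𝕜]
    [TopologicalSpace 𝕜] [IsTopologicalRing 𝕜] [TopologicalSpace A] [Semiring A] [Algebra 𝕜 A] :
    (gelfandTransform 𝕜 A).range.SeparatesPoints := by
  intro φ ψ hφψ
  obtain ⟨a, ha⟩ : ∃ a, φ a ≠ ψ a := by
    contrapose! hφψ
    exact CharacterSpace.ext hφψ
  exact ⟨_, ⟨_, ⟨a, rfl⟩, rfl⟩, ha⟩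

variable {A : Type*} [NormedCommRing A] [NormedAlgebra ℂ A] [CompleteSpace A]

instance isLocalHom_gelfandTransform : IsLocalHom (gelfandTransform ℂ A) where
  map_nonunit a ha := by
    rwa [← spectrum.zero_notMem_iff ℂ, ← spectrum.gelfandTransform_eq, spectrum.zero_notMem_iff]

theorem IsScattered.gelfandTransform_surjective (hscat : IsScattered (characterSpace ℂ A))
    (hclosed : IsClosed (range (gelfandTransform ℂ A))) :
    Function.Surjective (gelfandTransform ℂ A) :=
  (AlgHom.range_eq_top _).1 <| hscat.subalgebra_eq_top (by rwa [AlgHom.coe_range])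
    separatesPoints_range_gelfandTransform (isInverseClosed_range _)

theorem IsUniformAlgebra.isometry_gelfandTransform (hA : IsUniformAlgebra A) :
    Isometry (gelfandTransform ℂ A) := by
  obtain ⟨K, _, _, _, B, e, -, he⟩ := hA
  have hnorm (a : A) : ‖e a‖ = ‖a‖ := he.norm_map_of_map_zero (map_zero e) a
  have hone : ‖(1 : A)‖ ≤ 1 := by
    rw [← hnorm, map_one]
    exact (ContinuousMap.norm_le _ zero_le_one).2 fun x => by simp
  refine AddMonoidHomClass.isometry_of_norm _ fun a => le_antisymm ?_ ?_
  · refine (ContinuousMap.norm_le _ (norm_nonneg a)).2 fun φ => ?_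
    exact (AlgHom.norm_apply_le_self_mul_norm_one φ a).trans
      (mul_le_of_le_one_right (norm_nonneg a) hone)
  · rw [← hnorm]
    refine (ContinuousMap.norm_le _ (norm_nonneg _)).2 fun x => ?_
    let evalAt : characterSpace ℂ A := CharacterSpace.equivAlgHom.symm
      (((ContinuousMap.evalAlgHom ℂ ℂ x).comp B.val).comp (e : A →ₐ[ℂ] B))
    exact (gelfandTransform ℂ A a).norm_coe_le_norm evalAt

end Gelfand

theorem theorem3_general {A : Type*} [NormedCommRing A] [NormedAlgebra ℂ A] [CompleteSpace A]
    (hA : IsUniformAlgebra A) (hscat : IsScattered (characterSpace ℂ A)) :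
    Isometry (gelfandTransform ℂ A) ∧ Function.Bijective (gelfandTransform ℂ A) := by
  have hiso := hA.isometry_gelfandTransform
  exact ⟨hiso, hiso.injective,
    hscat.gelfandTransform_surjective hiso.isClosedEmbedding.isClosed_range⟩

/-- The equality `A = C(Δ(A))` means that the Gelfand transform is an isometric isomorphism of `A`
onto `C(Δ(A))`. -/
theorem theorem3 {A : Type*} [NormedCommRing A] [NormedAlgebra ℂ A] [CompleteSpace A]
    (hA : IsUniformAlgebra A) (hscat : IsScattered (WeakDual.characterSpace ℂ A))
    (hNP : MemNPInfty A) :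
    Isometry (WeakDual.gelfandTransform ℂ A) ∧
      Function.Bijective (WeakDual.gelfandTransform ℂ A) :=
  theorem3_general hA hscat
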